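/- Let $H\in(0,\tfrac12)$, let $B^H=\{B^H_t\}_{t\ge0}$ be a fractional Brownian motion with Hurst index $H$ on a probability space, i.e. a centred Gaussian process with covariance $\mathbb E[B^H_tB^H_s]=\tfrac12\left(t^{2H}+s^{2H}-|t-s|^{2H}\right)$ and almost surely continuous paths, and let $a,\sigma,X_0>0$ be constants. For $\varepsilon>0$ let $Y^\varepsilon$ be the (pathwise unique, continuous) solution of $$Y^\varepsilon_t=X_0+a\int_0^t\frac{ds}{Y^\varepsilon_s\mathbf 1_{\{Y^\varepsilon_s>0\}}+\varepsilon}+\sigma B^H_t,\qquad t\ge0,$$ and let $X^H_t=\lim_{\varepsilon\downarrow0}Y^\varepsilon_t$ be the fractional diffusion Bessel process. Then almost surely this limit exists (as a real number) for all $t\ge0$, and: (i) with probability $1$, $\liminf_{t\to\infty}X^H_t>0$; in particular there is a random time $T<\infty$ such that $X^H_t>0$ for all $t\ge T$; (ii) with probability $1$, for every $\alpha>\tfrac12$, $\limsup_{t\to\infty}X^H_t/t^\alpha=0$. -/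

import Mathlib

open MeasureTheory ProbabilityTheory Filter Topology Set
open scoped NNReal

/-- Fractional Brownian motion with Hurst index `H`: a centred Gaussian process on `[0, ∞)` with
covariance `(t ^ (2H) + s ^ (2H) - |t - s| ^ (2H)) / 2` and almost surely continuous paths. -/
structure IsFractionalBrownianMotion {Ω : Type*} [MeasurableSpace Ω]
    (H : ℝ) (B : ℝ≥0 → Ω → ℝ) (P : Measure Ω) : Prop where
  gaussian : IsGaussianProcess B P
  mean_zero : ∀ t, ∫ ω, B t ω ∂P = 0
  covariance : ∀ s t : ℝ≥0, ∫ ω, B t ω * B s ω ∂P =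
    ((t : ℝ) ^ (2 * H) + (s : ℝ) ^ (2 * H) - |(t : ℝ) - (s : ℝ)| ^ (2 * H)) / 2
  continuous_paths : ∀ᵐ ω ∂P, Continuous fun t => B t ω

namespace FracBessel

/-- The regularised drift `x ↦ 1 / (x 𝟙_{x > 0} + ε)`. -/
noncomputable def drift (ε x : ℝ) : ℝ := 1 / (x * indicator (Ioi 0) 1 x + ε)

/-- `y` is a (continuous) solution on `[0, ∞)` of
`y t = x₀ + a ∫₀ᵗ 1 / (y s 𝟙_{y s > 0} + ε) ds + σ b t`. -/
def IsApproxSolution (a σ x₀ ε : ℝ) (b y : ℝ≥0 → ℝ) : Prop :=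
  Continuous y ∧
    ∀ t : ℝ≥0, y t = x₀ + a * (∫ s in (0 : ℝ)..t, drift ε (y s.toNNReal)) + σ * b t

lemma drift_eq (ε x : ℝ) : drift ε x = 1 / (max x 0 + ε) := by
  unfold drift
  by_cases h : 0 < x
  · simp [h, h.le]
  · simp [h, not_lt.1 h]

lemma drift_nonneg {ε : ℝ} (hε : 0 < ε) (x : ℝ) : 0 ≤ drift ε x := by
  rw [drift_eq]
  have := le_max_right x 0
  positivity

lemma drift_le {ε : ℝ} (hε : 0 < ε) (x : ℝ) : drift ε x ≤ 1 / ε := by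
  rw [drift_eq]
  have := le_max_right x 0
  gcongr
  linarith

lemma continuous_drift {ε : ℝ} (hε : 0 < ε) : Continuous (drift ε) := by
  have h : drift ε = fun x => 1 / (max x 0 + ε) := funext (drift_eq ε)
  rw [h]
  refine Continuous.div continuous_const (by fun_prop) fun x => ?_
  have := le_max_right x 0
  positivity

lemma lipschitzWith_drift {ε : ℝ} (hε : 0 < ε) :
    LipschitzWith (1 / ε ^ 2).toNNReal (drift ε) := by
  refine LipschitzWith.of_dist_le_mul fun x y => ?_
  rw [Real.coe_toNNReal _ (by positivity), drift_eq, drift_eq, Real.dist_eq, Real.dist_eq]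
  have hx := le_max_right x 0
  have hy := le_max_right y 0
  have hx' : 0 < max x 0 + ε := by positivity
  have hy' : 0 < max y 0 + ε := by positivity
  have h1 : 1 / (max x 0 + ε) - 1 / (max y 0 + ε)
      = (max y 0 - max x 0) / ((max x 0 + ε) * (max y 0 + ε)) := by
    field_simp
    ring
  have h2 : |max y 0 - max x 0| ≤ |x - y| := by
    rw [abs_sub_comm x y]
    exact abs_max_sub_max_le_abs y x 0
  rw [h1, abs_div, abs_of_pos (mul_pos hx' hy'), div_le_iff₀ (mul_pos hx' hy')]
  have h3 : 1 ≤ 1 / ε ^ 2 * ((max x 0 + ε) * (max y 0 + ε)) := by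
    rw [one_div, inv_mul_eq_div, one_le_div (by positivity)]
    nlinarith
  calc |max y 0 - max x 0| ≤ |x - y| := h2
    _ ≤ |x - y| * (1 / ε ^ 2 * ((max x 0 + ε) * (max y 0 + ε))) :=
        le_mul_of_one_le_right (abs_nonneg _) h3
    _ = _ := by ring

lemma continuous_field {ε : ℝ} (hε : 0 < ε) {y : ℝ≥0 → ℝ} (hy : Continuous y) : Continuous fun s : ℝ => drift ε (y s.toNNReal) :=
  (continuous_drift hε).comp (hy.comp continuous_real_toNNReal)

lemma lipschitz_field {a ε : ℝ} (hε : 0 < ε) (c : ℝ) :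
    LipschitzWith (a.nnabs * (1 / ε ^ 2).toNNReal) fun u : ℝ => a * drift ε (u + c) := by
  refine LipschitzWith.of_dist_le_mul fun x y => ?_
  have h := (lipschitzWith_drift hε).dist_le_mul (x + c) (y + c)
  rw [dist_add_right] at h
  rw [Real.dist_eq, ← mul_sub, abs_mul, ← Real.dist_eq, NNReal.coe_mul, Real.coe_nnabs, mul_assoc]
  gcongr

/-- Along a continuous path `b` the regularised equation has exactly one solution. -/
theorem existsUnique_isApproxSolution (a σ x₀ : ℝ) {ε : ℝ} (hε : 0 < ε) {b : ℝ≥0 → ℝ}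
    (hb : Continuous b) : ∃! y, IsApproxSolution a σ x₀ ε b y := by
  set f : ℝ → ℝ → ℝ := fun t u => a * drift ε (u + σ * b t.toNNReal) with hf
  have hlip : ∀ t, LipschitzWith (a.nnabs * (1 / ε ^ 2).toNNReal) (f t) := fun t =>
    lipschitz_field hε _
  have hbR : Continuous fun t : ℝ => σ * b t.toNNReal :=
    continuous_const.mul (hb.comp continuous_real_toNNReal)
  have hnorm : ∀ t u, ‖f t u‖ ≤ (a.nnabs * (1 / ε).toNNReal : ℝ≥0) := by
    intro t u
    rw [NNReal.coe_mul, Real.coe_nnabs, Real.coe_toNNReal _ (by positivity), hf, norm_mul,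
      Real.norm_eq_abs, Real.norm_eq_abs, abs_of_nonneg (drift_nonneg hε _)]
    exact mul_le_mul_of_nonneg_left (drift_le hε _) (abs_nonneg _)
  -- differential form of the equation
  have hderiv : ∀ y, IsApproxSolution a σ x₀ ε b y →
      ∃ u : ℝ → ℝ, Continuous u ∧ u 0 = x₀ ∧ (∀ t : ℝ≥0, u t = y t - σ * b t) ∧
        ∀ t, 0 ≤ t → HasDerivWithinAt u (f t (u t)) (Ici t) t := by
    rintro y ⟨hyc, hy⟩
    have hc : Continuous fun s : ℝ => a * drift ε (y s.toNNReal) :=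
      continuous_const.mul (continuous_field hε hyc)
    have hd : ∀ t : ℝ, HasDerivAt (fun t : ℝ => x₀ + ∫ s in (0 : ℝ)..t,
        a * drift ε (y s.toNNReal)) (a * drift ε (y t.toNNReal)) t := fun t =>
      (hc.integral_hasStrictDerivAt 0 t).hasDerivAt.const_add _
    have heq : ∀ t : ℝ≥0, (x₀ + ∫ s in (0 : ℝ)..t, a * drift ε (y s.toNNReal))
        = y t - σ * b t := by
      intro t
      rw [hy t, intervalIntegral.integral_const_mul]
      ring
    refine ⟨_, continuous_iff_continuousAt.2 fun t => (hd t).continuousAt, by simp, heq, ?_⟩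
    intro t ht
    have h1 := heq t.toNNReal
    rw [Real.coe_toNNReal t ht] at h1
    have h2 : f t (x₀ + ∫ s in (0 : ℝ)..t, a * drift ε (y s.toNNReal))
        = a * drift ε (y t.toNNReal) := by
      rw [hf]
      simp only [h1, sub_add_cancel]
    rw [h2]
    exact (hd t).hasDerivWithinAt
  -- local solutions
  have hex : ∀ N : ℕ, ∃ u : ℝ → ℝ, u 0 = x₀ ∧
      ∀ t ∈ Icc (0 : ℝ) N, HasDerivWithinAt u (f t (u t)) (Icc 0 (N : ℝ)) t := by
    intro N
    have hPL : IsPicardLindelof f (tmin := 0) (tmax := N) ⟨0, by simp⟩ x₀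
        ((a.nnabs * (1 / ε).toNNReal) * N) 0 (a.nnabs * (1 / ε).toNNReal)
        (a.nnabs * (1 / ε ^ 2).toNNReal) :=
      { lipschitzOnWith := fun t _ => (hlip t).lipschitzOnWith
        continuousOn := fun x _ => by
          refine Continuous.continuousOn ?_
          exact continuous_const.mul ((continuous_drift hε).comp (continuous_const.add hbR))
        norm_le := fun t _ x _ => hnorm t x
        mul_max_le := by simp }
    exact hPL.exists_eq_forall_mem_Icc_hasDerivWithinAt₀
  choose v hv0 hv using hex
  have hvc : ∀ N, ContinuousOn (v N) (Icc 0 (N : ℝ)) := fun N t ht =>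
    (hv N t ht).continuousWithinAt
  have hvr : ∀ N : ℕ, ∀ t ∈ Ico (0 : ℝ) N, HasDerivWithinAt (v N) (f t (v N t)) (Ici t) t := by
    intro N t ht
    refine (hv N t ⟨ht.1, ht.2.le⟩).mono_of_mem_nhdsWithin ?_
    exact mem_of_superset (Icc_mem_nhdsGE ht.2) (Icc_subset_Icc_left ht.1)
  have hagree : ∀ M N : ℕ, M ≤ N → EqOn (v M) (v N) (Icc 0 (M : ℝ)) := by
    intro M N hMN
    have hMN' : (M : ℝ) ≤ N := by exact_mod_cast hMN
    exact ODE_solution_unique hlip (hvc M) (hvr M)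
      ((hvc N).mono (Icc_subset_Icc_right hMN'))
      (fun t ht => hvr N t ⟨ht.1, ht.2.trans_le hMN'⟩) ((hv0 M).trans (hv0 N).symm)
  -- the global solution
  set u : ℝ → ℝ := fun t => v (⌈t⌉₊) t with hu
  have huv : ∀ N : ℕ, EqOn u (v N) (Icc 0 (N : ℝ)) := fun N t ht =>
    hagree _ N (Nat.ceil_le.2 ht.2) ⟨ht.1, Nat.le_ceil t⟩
  have huc : Continuous fun t : ℝ≥0 => u t := by
    refine continuous_iff_continuousAt.2 fun t => ?_
    obtain ⟨N, hN⟩ := exists_nat_gt (t : ℝ)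
    have h1 : ∀ᶠ s : ℝ≥0 in 𝓝 t, (s : ℝ) ∈ Icc (0 : ℝ) N := by
      filter_upwards [(NNReal.continuous_coe.tendsto t).eventually_lt_const hN] with s hs
      exact ⟨s.coe_nonneg, hs.le⟩
    have h2 : Tendsto (fun s : ℝ≥0 => (s : ℝ)) (𝓝 t) (𝓝[Icc (0 : ℝ) N] (t : ℝ)) :=
      tendsto_nhdsWithin_iff.2 ⟨NNReal.continuous_coe.tendsto t, h1⟩
    have h3 : Tendsto (fun s : ℝ≥0 => v N s) (𝓝 t) (𝓝 (v N t)) :=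
      (hvc N t ⟨t.coe_nonneg, hN.le⟩).tendsto.comp h2
    rw [ContinuousAt, huv N ⟨t.coe_nonneg, hN.le⟩]
    exact h3.congr' (h1.mono fun s hs => (huv N hs).symm)
  refine ⟨fun t => u t + σ * b t, ⟨huc.add (continuous_const.mul hb), fun t => ?_⟩, ?_⟩
  · have hyc : Continuous fun t : ℝ≥0 => u t + σ * b t := huc.add (continuous_const.mul hb)
    have hc : Continuous fun s : ℝ => a * drift ε (u (s.toNNReal) + σ * b s.toNNReal) :=
      continuous_const.mul (continuous_field hε hyc)
    set N := ⌈(t : ℝ)⌉₊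
    have htN : (t : ℝ) ≤ N := Nat.le_ceil _
    have h := intervalIntegral.integral_eq_sub_of_hasDeriv_right_of_le (f := v N)
      (f' := fun s : ℝ => a * drift ε (u (s.toNNReal) + σ * b s.toNNReal)) t.coe_nonneg
      ((hvc N).mono (Icc_subset_Icc_right htN)) (fun s hs => ?_) (hc.intervalIntegrable _ _)
    · rw [← intervalIntegral.integral_const_mul]
      beta_reduce
      rw [h, hv0 N, huv N ⟨t.coe_nonneg, htN⟩]
      ring
    · have hsN : s ∈ Ico (0 : ℝ) N := ⟨hs.1.le, hs.2.trans_le htN⟩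
      have h4 := (hvr N s hsN).mono Ioi_subset_Ici_self
      rw [← huv N ⟨hsN.1, hsN.2.le⟩] at h4
      simpa only [hf, Real.coe_toNNReal s hs.1.le] using h4
  · intro y hy
    have hy' : IsApproxSolution a σ x₀ ε b y := hy
    obtain ⟨w, hwc, hw0, hwy, hwd⟩ := hderiv y hy'
    ext t
    set N := ⌈(t : ℝ)⌉₊
    have htN : (t : ℝ) ≤ N := Nat.le_ceil _
    have h := ODE_solution_unique hlip hwc.continuousOn (fun s hs => hwd s hs.1) (hvc N) (hvr N)
      (hw0.trans (hv0 N).symm) ⟨t.coe_nonneg, htN⟩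
    have h1 := hwy t
    rw [h, ← huv N ⟨t.coe_nonneg, htN⟩] at h1
    linarith

open Classical in
/-- The solution of the regularised equation driven by the path `b`
(set to `0` for discontinuous paths or `ε ≤ 0`). -/
noncomputable def approx (a σ x₀ ε : ℝ) (b : ℝ≥0 → ℝ) : ℝ≥0 → ℝ :=
  if h : 0 < ε ∧ Continuous b then
    (existsUnique_isApproxSolution a σ x₀ h.1 h.2).choose
  else 0

lemma isApproxSolution_approx (a σ x₀ : ℝ) {ε : ℝ} (hε : 0 < ε) {b : ℝ≥0 → ℝ}
    (hb : Continuous b) : IsApproxSolution a σ x₀ ε b (approx a σ x₀ ε b) := by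
  rw [approx, dif_pos ⟨hε, hb⟩]
  exact (existsUnique_isApproxSolution a σ x₀ hε hb).choose_spec.1

/-- The path of the fractional diffusion Bessel process driven by `b`: the pointwise limit, as
`ε ↓ 0`, of the solutions of the regularised equations. -/
noncomputable def path (a σ x₀ : ℝ) (b : ℝ≥0 → ℝ) (t : ℝ≥0) : ℝ :=
  limUnder (𝓝[>] (0 : ℝ)) fun ε => approx a σ x₀ ε b t

end FracBessel

/-- The fractional diffusion Bessel process with parameters `a`, `σ`, initial value `x₀` and
driving process `B`. -/
noncomputable def fracBessel {Ω : Type*} (a σ x₀ : ℝ) (B : ℝ≥0 → Ω → ℝ) (t : ℝ≥0) (ω : Ω) : ℝ :=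
  FracBessel.path a σ x₀ (fun s => B s ω) t

/-! Everything reduces to a pathwise estimate for a continuous driver with `|b t| ≤ C (1 + t) ^ γ`,
`H < γ < 1/2`. Fix a level `K` and restart the equation from the last visit to one side of it. Above
`K` the drift is at most `a / K`, so `y t ≤ K + a t / K + 2 σ M` with `M` bounding `|b|` on `[0,
t]`; `K` of order `√t` gives growth `O(√t)` and hence (ii). Below `K` the drift is at least `a / (K
+ ε)`: either the path has been at `K` and lost at most `2 σ M` since, or the drift alone has
contributed `a t / (K + ε)`. With `K = 2 σ M + 1` both cases give `y t ≥ 1` eventually, because `M ^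
2 = o(t)`; this is (i). The bounds survive `ε ↓ 0`, a monotone limit by comparison (`anti`).

The growth of the driver comes from high Gaussian moments of dyadic increments on all intervals `[0,
2 ^ n]` at once (`ae_exists_increment_bound`), followed by chaining (`exists_growth_bound`). -/

/-- Along a continuous path, the last time at which a closed sublevel set is visited. -/
lemma exists_last_le {f : ℝ≥0 → ℝ} (hf : Continuous f) (K : ℝ) (t : ℝ≥0) :
    (∀ s ≤ t, K < f s) ∨ ∃ s ≤ t, f s ≤ K ∧ ∀ r, s < r → r ≤ t → K < f r := by
  by_cases h : ∀ s ≤ t, K < f s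
  · exact .inl h
  push Not at h
  obtain ⟨s₀, hs₀, hfs₀⟩ := h
  have hc : IsCompact (Icc 0 t ∩ f ⁻¹' Iic K) := isCompact_Icc.inter_right (isClosed_Iic.preimage hf)
  obtain ⟨s, ⟨hs, hfs⟩, hmax⟩ := hc.exists_isGreatest ⟨s₀, ⟨⟨zero_le, hs₀⟩, hfs₀⟩⟩
  refine .inr ⟨s, hs.2, hfs, fun r hr hrt => ?_⟩
  by_contra! hle
  exact absurd (hmax ⟨⟨zero_le, hrt⟩, hle⟩) (not_le.2 hr)

/-! ### Bounds and comparison for the regularised equation -/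

namespace FracBessel

lemma drift_le_one_div {ε K x : ℝ} (hε : 0 < ε) (hK : 0 < K) (h : K ≤ x) :
    drift ε x ≤ 1 / K := by
  rw [drift_eq, max_eq_left (hK.le.trans h)]
  gcongr
  linarith

lemma drift_antitone {ε : ℝ} (hε : 0 < ε) : Antitone (drift ε) := by
  intro x y hxy
  rw [drift_eq, drift_eq]
  have := le_max_right x 0
  gcongr

lemma drift_anti_left {ε₁ ε₂ : ℝ} (hε : 0 < ε₁) (h : ε₁ ≤ ε₂) (x : ℝ) :
    drift ε₂ x ≤ drift ε₁ x := by
  rw [drift_eq, drift_eq]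
  have := le_max_right x 0
  gcongr

lemma one_div_le_drift {ε K x : ℝ} (hε : 0 < ε) (hK : 0 < K) (h : x ≤ K) :
    1 / (K + ε) ≤ drift ε x := by
  have := drift_antitone hε h
  rwa [drift_eq ε K, max_eq_left hK.le] at this

namespace IsApproxSolution

variable {a σ x₀ ε : ℝ} {b y : ℝ≥0 → ℝ}

lemma intervalIntegrable (hy : IsApproxSolution a σ x₀ ε b y) (hε : 0 < ε) (s t : ℝ) :
    IntervalIntegrable (fun r : ℝ => drift ε (y r.toNNReal)) volume s t :=
  (continuous_field hε hy.1).intervalIntegrable _ _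

lemma sub_eq (hy : IsApproxSolution a σ x₀ ε b y) (hε : 0 < ε) (s t : ℝ≥0) :
    y t - y s = a * (∫ r in (s : ℝ)..t, drift ε (y r.toNNReal)) + σ * (b t - b s) := by
  rw [← intervalIntegral.integral_interval_sub_left (hy.intervalIntegrable hε 0 t)
    (hy.intervalIntegrable hε 0 s), hy.2 t, hy.2 s]
  ring

lemma integral_le (hy : IsApproxSolution a σ x₀ ε b y) (hε : 0 < ε) {K : ℝ} (hK : 0 < K)
    {s t : ℝ≥0} (hst : s ≤ t) (h : ∀ r, s < r → r ≤ t → K < y r) :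
    ∫ r in (s : ℝ)..t, drift ε (y r.toNNReal) ≤ (t - s) / K := by
  have h1 := intervalIntegral.integral_mono_on_of_le_Ioo (NNReal.coe_le_coe.2 hst)
    (hy.intervalIntegrable hε s t) (intervalIntegrable_const (c := 1 / K)) (fun r hr => ?_)
  · rw [intervalIntegral.integral_const, smul_eq_mul, mul_one_div] at h1
    exact h1
  · have hr0 : (0 : ℝ) ≤ r := s.coe_nonneg.trans hr.1.le
    refine drift_le_one_div hε hK (h _ ?_ ?_).le
    · exact (Real.lt_toNNReal_iff_coe_lt).2 hr.1
    · exact Real.toNNReal_le_iff_le_coe.2 hr.2.le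

lemma le_integral (hy : IsApproxSolution a σ x₀ ε b y) (hε : 0 < ε) {K : ℝ} (hK : 0 < K)
    {s t : ℝ≥0} (hst : s ≤ t) (h : ∀ r, s < r → r ≤ t → y r < K) :
    (t - s) / (K + ε) ≤ ∫ r in (s : ℝ)..t, drift ε (y r.toNNReal) := by
  have h1 := intervalIntegral.integral_mono_on_of_le_Ioo (NNReal.coe_le_coe.2 hst)
    (intervalIntegrable_const (c := 1 / (K + ε))) (hy.intervalIntegrable hε s t) (fun r hr => ?_)
  · rw [intervalIntegral.integral_const, smul_eq_mul, mul_one_div] at h1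
    exact h1
  · have hr0 : (0 : ℝ) ≤ r := s.coe_nonneg.trans hr.1.le
    refine one_div_le_drift hε hK (h _ ?_ ?_).le
    · exact (Real.lt_toNNReal_iff_coe_lt).2 hr.1
    · exact Real.toNNReal_le_iff_le_coe.2 hr.2.le

/-- Upper bound uniform in the regularisation parameter. -/
lemma le_of_abs_le (hy : IsApproxSolution a σ x₀ ε b y) (hε : 0 < ε) (ha : 0 < a) (hσ : 0 < σ)
    {K M : ℝ} (hK : 0 < K) (hxK : x₀ ≤ K) {t : ℝ≥0} (hM : ∀ s ≤ t, |b s| ≤ M) :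
    y t ≤ K + a * (t / K) + 2 * (σ * M) := by
  have ht := abs_le.1 (hM t le_rfl)
  have h0M : 0 ≤ M := (abs_nonneg _).trans (hM t le_rfl)
  have hbt : σ * b t ≤ σ * M := mul_le_mul_of_nonneg_left ht.2 hσ.le
  have hσM : 0 ≤ σ * M := by positivity
  -- After the last visit to `(-∞, K]` the drift is at most `a / K`; the noise increment costs `2 σ
  -- M`. If there is no visit, `x₀ ≤ K` plays the role of the starting level.
  rcases exists_last_le hy.1 K t with h | ⟨s, hst, hs, h⟩
  · have h1 := hy.integral_le hε hK (zero_le (a := t)) (fun r _ hr => h r hr)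
    rw [NNReal.coe_zero, sub_zero] at h1
    have h2 := mul_le_mul_of_nonneg_left h1 ha.le
    have h3 := hy.2 t
    linarith
  · have h1 := mul_le_mul_of_nonneg_left (hy.integral_le hε hK hst h) ha.le
    have h2 := hy.sub_eq hε s t
    have hbs := mul_le_mul_of_nonneg_left (abs_le.1 (hM s hst)).1 hσ.le
    have h3 : a * ((t - s) / K) ≤ a * (t / K) := by
      gcongr
      linarith [s.coe_nonneg]
    linarith

/-- Since the drift is nonnegative, only the noise can pull the path down after its last visit to
`[K, ∞)`. A path that never visits that set has felt drift at least `a / (K + ε)` throughout. -/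
lemma min_le_of_abs_le (hy : IsApproxSolution a σ x₀ ε b y) (hε : 0 < ε) (ha : 0 < a)
    (hσ : 0 < σ) {K M : ℝ} (hK : 0 < K) {t : ℝ≥0} (hM : ∀ s ≤ t, |b s| ≤ M) :
    min (K - 2 * (σ * M)) (x₀ + a * (t / (K + ε)) - σ * M) ≤ y t := by
  have hbt := mul_le_mul_of_nonneg_left (abs_le.1 (hM t le_rfl)).1 hσ.le
  rcases exists_last_le hy.1.neg (-K) t with h | ⟨s, hst, hs, h⟩
  · refine (min_le_right _ _).trans ?_
    have h1 := hy.le_integral hε hK (zero_le (a := t)) (fun r _ hr => neg_lt_neg_iff.1 (h r hr))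
    rw [NNReal.coe_zero, sub_zero] at h1
    have h2 := mul_le_mul_of_nonneg_left h1 ha.le
    have h3 := hy.2 t
    linarith
  · refine (min_le_left _ _).trans ?_
    have h1 := hy.le_integral hε hK hst (fun r hr hr' => neg_lt_neg_iff.1 (h r hr hr'))
    have h2 := hy.sub_eq hε s t
    have hbs := mul_le_mul_of_nonneg_left (abs_le.1 (hM s hst)).2 hσ.le
    have hst' : (s : ℝ) ≤ t := NNReal.coe_le_coe.2 hst
    have h4 : 0 ≤ ((t : ℝ) - s) / (K + ε) := div_nonneg (by linarith) (by linarith)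
    have h3 := mul_nonneg ha.le (h4.trans h1)
    have hs' := neg_le_neg_iff.1 hs
    linarith

/-- Comparison: the solution decreases as the regularisation parameter increases. -/
lemma anti {ε₁ ε₂ : ℝ} {y₁ y₂ : ℝ≥0 → ℝ} (h₁ : IsApproxSolution a σ x₀ ε₁ b y₁)
    (h₂ : IsApproxSolution a σ x₀ ε₂ b y₂) (ha : 0 < a) (hε : 0 < ε₁) (h : ε₁ ≤ ε₂) (t : ℝ≥0) :
    y₂ t ≤ y₁ t := by
  have hε₂ : 0 < ε₂ := hε.trans_le h
  -- Wherever `y₂ > y₁`, the drift of `y₂` is the smaller one, being antitone in both the state and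
  -- `ε`; the noise cancels. So the gap `y₂ - y₁` cannot grow after the last time it was
  -- nonpositive.
  have key : ∀ s ≤ t, (∀ r, s < r → r ≤ t → 0 < y₂ r - y₁ r) →
      y₂ t - y₂ s ≤ y₁ t - y₁ s := by
    intro s hst hr
    rw [h₁.sub_eq hε, h₂.sub_eq hε₂]
    gcongr
    refine intervalIntegral.integral_mono_on_of_le_Ioo (NNReal.coe_le_coe.2 hst)
      (h₂.intervalIntegrable hε₂ s t) (h₁.intervalIntegrable hε s t) fun r hr' => ?_
    have h3 := hr r.toNNReal (Real.lt_toNNReal_iff_coe_lt.2 hr'.1)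
      (Real.toNNReal_le_iff_le_coe.2 hr'.2.le)
    exact (drift_antitone hε₂ (sub_pos.1 h3).le).trans (drift_anti_left hε h _)
  rcases exists_last_le (h₂.1.sub h₁.1) 0 t with h0 | ⟨s, hst, hs, h0⟩
  · have h3 := h₁.2 0
    have h4 := h₂.2 0
    simp only [NNReal.coe_zero, intervalIntegral.integral_same] at h3 h4
    have := key 0 zero_le fun r _ hr => h0 r hr
    linarith
  · have := key s hst h0
    have hs' : y₂ s - y₁ s ≤ 0 := hs
    linarith

end IsApproxSolution

/-! ### Passage to the limit in the regularisation parameter -/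

variable {a σ x₀ : ℝ} {b : ℝ≥0 → ℝ}

lemma exists_abs_le (hb : Continuous b) (t : ℝ≥0) : ∃ M, ∀ s ≤ t, |b s| ≤ M := by
  obtain ⟨M, hM⟩ := isCompact_Icc.exists_bound_of_continuousOn (s := Icc 0 t) hb.continuousOn
  exact ⟨M, fun s hs => hM s ⟨zero_le, hs⟩⟩

/-- Monotonicity in `ε` and an upper bound free of `ε` force convergence, so the `limUnder` in
`path` is a genuine limit. -/
theorem tendsto_approx_path (ha : 0 < a) (hσ : 0 < σ) (hb : Continuous b) (t : ℝ≥0) :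
    Tendsto (fun ε => approx a σ x₀ ε b t) (𝓝[>] (0 : ℝ)) (𝓝 (path a σ x₀ b t)) := by
  obtain ⟨M, hM⟩ := exists_abs_le hb t
  have hmono : MonotoneOn (fun ε => -approx a σ x₀ ε b t) (Ioi 0) := fun ε₁ h₁ ε₂ h₂ h =>
    neg_le_neg ((isApproxSolution_approx a σ x₀ h₁ hb).anti
      (isApproxSolution_approx a σ x₀ h₂ hb) ha h₁ h t)
  have hbdd : BddBelow ((fun ε => -approx a σ x₀ ε b t) '' Ioi 0) := by
    refine ⟨-(max x₀ 1 + a * (t / max x₀ 1) + 2 * (σ * M)), ?_⟩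
    rintro _ ⟨ε, hε, rfl⟩
    exact neg_le_neg ((isApproxSolution_approx a σ x₀ hε hb).le_of_abs_le hε ha hσ
      (zero_lt_one.trans_le (le_max_right _ _)) (le_max_left _ _) hM)
  have h := (hmono.tendsto_nhdsGT hbdd).neg
  simp only [neg_neg] at h
  exact tendsto_nhds_limUnder ⟨_, h⟩

lemma path_le (ha : 0 < a) (hσ : 0 < σ) (hb : Continuous b) {K M : ℝ} (hK : 0 < K)
    (hxK : x₀ ≤ K) {t : ℝ≥0} (hM : ∀ s ≤ t, |b s| ≤ M) :
    path a σ x₀ b t ≤ K + a * (t / K) + 2 * (σ * M) :=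
  le_of_tendsto (tendsto_approx_path ha hσ hb t) <| eventually_mem_nhdsWithin.mono fun _ hε =>
    (isApproxSolution_approx a σ x₀ hε hb).le_of_abs_le hε ha hσ hK hxK hM

/-- The limit dominates the solution with `ε = 1`, whence the `K + 1`. -/
lemma min_le_path (ha : 0 < a) (hσ : 0 < σ) (hb : Continuous b) {K M : ℝ} (hK : 0 < K)
    {t : ℝ≥0} (hM : ∀ s ≤ t, |b s| ≤ M) :
    min (K - 2 * (σ * M)) (x₀ + a * (t / (K + 1)) - σ * M) ≤ path a σ x₀ b t := by
  have h1 := isApproxSolution_approx a σ x₀ one_pos hb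
  refine (h1.min_le_of_abs_le one_pos ha hσ hK hM).trans ?_
  refine ge_of_tendsto (tendsto_approx_path ha hσ hb t) ?_
  filter_upwards [Ioc_mem_nhdsGT (one_pos (α := ℝ))] with ε hε
  exact (isApproxSolution_approx a σ x₀ hε.1 hb).anti h1 ha hε.1 hε.2 t

end FracBessel

/-! ### Long-time behaviour along a driver of growth exponent below 1/2 -/

namespace FracBessel

variable {a σ x₀ : ℝ} {b : ℝ≥0 → ℝ}

lemma eventually_mul_rpow_add_le {c d a γ : ℝ} (ha : 0 < a) (hγ : γ < 1) :
    ∀ᶠ u : ℝ in atTop, c * u ^ γ + d ≤ a * u := by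
  have h1 : (fun u : ℝ => c * u ^ γ) =o[atTop] fun u : ℝ => u := by
    refine (Asymptotics.isLittleO_of_tendsto' ?_ ?_).const_mul_left c
    · filter_upwards [eventually_ne_atTop 0] with u hu h0
      exact absurd h0 hu
    · refine (tendsto_rpow_neg_atTop (sub_pos.2 hγ)).congr' ?_
      filter_upwards [eventually_gt_atTop 0] with u hu
      rw [neg_sub, Real.rpow_sub_one hu.ne']
  have h2 : (fun _ : ℝ => d) =o[atTop] fun u : ℝ => u :=
    Asymptotics.isLittleO_const_id_atTop d
  filter_upwards [(h1.add h2).bound ha, eventually_ge_atTop 0] with u hu hu0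
  rw [Real.norm_of_nonneg hu0] at hu
  exact (le_abs_self _).trans hu

lemma tendsto_one_add_coe_atTop : Tendsto (fun t : ℝ≥0 => 1 + (t : ℝ)) atTop atTop :=
  tendsto_atTop_add_const_left _ _ (NNReal.tendsto_coe_atTop.2 tendsto_id)

lemma one_add_sq_le {D v : ℝ} (hD : 0 ≤ D) (hv : 1 ≤ v) :
    (1 + D * v) ^ 2 ≤ (1 + D) ^ 2 * v ^ 2 := by
  rw [← mul_pow]
  gcongr
  nlinarith

lemma abs_le_of_growth {C γ : ℝ} (hC : 0 ≤ C) (hγ : 0 ≤ γ)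
    (hb : ∀ t, |b t| ≤ C * (1 + (t : ℝ)) ^ γ) (t : ℝ≥0) :
    ∀ s ≤ t, |b s| ≤ C * (1 + (t : ℝ)) ^ γ := by
  intro s hst
  refine (hb s).trans ?_
  gcongr

theorem eventually_one_le_path (ha : 0 < a) (hσ : 0 < σ) (hx₀ : 0 < x₀) (hbc : Continuous b)
    {C γ : ℝ} (hC : 0 ≤ C) (hγ0 : 0 ≤ γ) (hγ : γ < 1 / 2)
    (hb : ∀ t, |b t| ≤ C * (1 + (t : ℝ)) ^ γ) :
    ∀ᶠ t in atTop, 1 ≤ path a σ x₀ b t := by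
  -- The target is `2 (1 + σ M) ^ 2 ≤ a t` with `M = C (1 + t) ^ γ`. The exponent `γ * 2 < 1` makes
  -- it hold eventually, and `d = a` absorbs the shift from `t` to `1 + t`.
  have h1 := tendsto_one_add_coe_atTop.eventually (eventually_mul_rpow_add_le
    (c := 2 * (1 + σ * C) ^ 2) (d := a) ha (γ := γ * 2) (by linarith))
  filter_upwards [h1] with t ht
  have hu : (1 : ℝ) ≤ 1 + t := by linarith [t.coe_nonneg]
  have hv : 1 ≤ (1 + (t : ℝ)) ^ γ := Real.one_le_rpow hu hγ0
  rw [Real.rpow_mul (by linarith), Real.rpow_two] at ht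
  set v := (1 + (t : ℝ)) ^ γ with hvdef
  have hD : 0 ≤ σ * C := by positivity
  have h2 := one_add_sq_le hD hv
  have hDv : 0 ≤ σ * (C * v) := by positivity
  -- This level makes the first term of the minimum exactly `1`.
  refine le_trans ?_ (min_le_path (x₀ := x₀) ha hσ hbc (K := 2 * (σ * (C * v)) + 1)
    (by positivity) (abs_le_of_growth hC hγ0 hb t))
  rw [← hvdef]
  refine le_min (by linarith) ?_
  have h3 : 1 + σ * (C * v) ≤ a * (t / (2 * (σ * (C * v)) + 1 + 1)) := by
    rw [← mul_div_assoc, le_div_iff₀ (by positivity)]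
    nlinarith
  linarith

theorem tendsto_path_div_rpow (ha : 0 < a) (hσ : 0 < σ) (hx₀ : 0 < x₀) (hbc : Continuous b)
    {C γ : ℝ} (hC : 0 ≤ C) (hγ0 : 0 ≤ γ) (hγ : γ < 1 / 2)
    (hb : ∀ t, |b t| ≤ C * (1 + (t : ℝ)) ^ γ) {α : ℝ} (hα : 1 / 2 < α) :
    Tendsto (fun t : ℝ≥0 => path a σ x₀ b t / (t : ℝ) ^ α) atTop (𝓝 0) := by
  set D : ℝ := x₀ + 1 + a + 2 * (σ * C)
  have hlim : Tendsto (fun t : ℝ≥0 => D * 2 ^ (1 / 2 : ℝ) * (t : ℝ) ^ (-(α - 1 / 2)))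
      atTop (𝓝 0) := by
    simpa using ((tendsto_rpow_neg_atTop (sub_pos.2 hα)).comp
      (NNReal.tendsto_coe_atTop.2 tendsto_id)).const_mul (D * 2 ^ (1 / 2 : ℝ))
  refine tendsto_of_tendsto_of_tendsto_of_le_of_le' tendsto_const_nhds hlim ?_ ?_
  · filter_upwards [eventually_one_le_path ha hσ hx₀ hbc hC hγ0 hγ hb] with t ht
    positivity
  · filter_upwards [eventually_ge_atTop 1] with t ht
    have ht1 : (1 : ℝ) ≤ t := by exact_mod_cast ht
    have ht0 : (0 : ℝ) < t := by linarith
    have hw : 1 ≤ (1 + (t : ℝ)) ^ (1 / 2 : ℝ) := Real.one_le_rpow (by linarith) (by norm_num)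
    have hv : (1 + (t : ℝ)) ^ γ ≤ (1 + (t : ℝ)) ^ (1 / 2 : ℝ) :=
      Real.rpow_le_rpow_of_exponent_le (by linarith) hγ.le
    have hww : (1 + (t : ℝ)) ^ (1 / 2 : ℝ) * (1 + (t : ℝ)) ^ (1 / 2 : ℝ) = 1 + t := by
      rw [← Real.rpow_add (by linarith)]
      norm_num
    have hw2 : (1 + (t : ℝ)) ^ (1 / 2 : ℝ) ≤ 2 ^ (1 / 2 : ℝ) * (t : ℝ) ^ (1 / 2 : ℝ) := by
      rw [← Real.mul_rpow (by norm_num) ht0.le]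
      exact Real.rpow_le_rpow (by linarith) (by linarith) (by norm_num)
    set w := (1 + (t : ℝ)) ^ (1 / 2 : ℝ)
    -- A level of order `√(1 + t)` balances `K` against `a t / K`; adding `x₀` ensures `x₀ ≤ K`.
    have h1 := path_le (x₀ := x₀) ha hσ hbc (K := x₀ + w) (by linarith) (by linarith)
      (abs_le_of_growth hC hγ0 hb t)
    have h2 : (t : ℝ) / (x₀ + w) ≤ w := by
      rw [div_le_iff₀ (by linarith)]
      nlinarith
    have h3 : path a σ x₀ b t ≤ D * w := by
      have h4 := mul_le_mul_of_nonneg_left h2 ha.le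
      have h5 := mul_le_mul_of_nonneg_left hv (mul_nonneg hσ.le hC)
      have h6 : x₀ ≤ x₀ * w := le_mul_of_one_le_right hx₀.le hw
      have h7 : D * w = x₀ * w + w + a * w + 2 * (σ * C * w) := by ring
      have h8 : 2 * (σ * (C * (1 + (t : ℝ)) ^ γ)) = 2 * (σ * C * (1 + (t : ℝ)) ^ γ) := by ring
      linarith
    rw [div_le_iff₀ (by positivity), mul_assoc, ← Real.rpow_add ht0]
    calc path a σ x₀ b t ≤ D * w := h3
      _ ≤ D * (2 ^ (1 / 2 : ℝ) * (t : ℝ) ^ (1 / 2 : ℝ)) := by gcongr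
      _ = _ := by
        rw [mul_assoc]
        congr 3
        ring

end FracBessel

/-! ### Dyadic chaining: from grid increments to a growth bound -/

namespace DyadicChaining

/-- The `j`-th point of the dyadic partition of `[0, 2 ^ n]` into `2 ^ k` intervals. -/
noncomputable def grid (n k j : ℕ) : ℝ≥0 := 2 ^ n * (j / 2 ^ k)

lemma grid_zero (n k : ℕ) : grid n k 0 = 0 := by simp [grid]

lemma grid_succ_two_mul (n k m : ℕ) : grid n (k + 1) (2 * m) = grid n k m := by
  simp only [grid, pow_succ]
  push_cast
  rw [mul_comm (2 : ℝ≥0) m, mul_div_mul_right _ _ two_ne_zero]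

lemma coe_grid_succ_sub (n k j : ℕ) :
    (grid n k (j + 1) : ℝ) - grid n k j = 2 ^ n / 2 ^ k := by
  simp only [grid]
  push_cast
  ring

lemma tendsto_grid (n : ℕ) (t : ℝ≥0) :
    Tendsto (fun k : ℕ => grid n k ⌊(t : ℝ) / 2 ^ n * 2 ^ k⌋₊) atTop (𝓝 t) := by
  have h := ((tendsto_nat_floor_mul_div_atTop (R := ℝ) (a := (t : ℝ) / 2 ^ n) (by positivity)).comp
    (tendsto_pow_atTop_atTop_of_one_lt (one_lt_two (α := ℝ)))).const_mul ((2 : ℝ) ^ n)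
  rw [mul_div_cancel₀ _ (by positivity)] at h
  rw [← NNReal.tendsto_coe]
  refine h.congr fun k => ?_
  simp [grid]

/-- Even points of level `k + 1` already lie in level `k`, and an odd point is one increment away
from its left neighbour, so each level costs only one term `A * r ^ k`. -/
lemma abs_grid_le {b : ℝ≥0 → ℝ} {A r : ℝ} {n : ℕ} (hA : 0 ≤ A) (hr : 0 ≤ r)
    (h : ∀ k j, j < 2 ^ k → |b (grid n k (j + 1)) - b (grid n k j)| ≤ A * r ^ k) (k : ℕ) :
    ∀ j ≤ 2 ^ k, |b (grid n k j)| ≤ |b 0| + A * ∑ i ∈ Finset.range (k + 1), r ^ i := by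
  have step : ∀ (k j : ℕ) (c : ℝ), j < 2 ^ k → |b (grid n k j)| ≤ c →
      |b (grid n k (j + 1))| ≤ c + A * r ^ k := by
    intro k j c hj hc
    have h1 := abs_sub_abs_le_abs_sub (b (grid n k (j + 1))) (b (grid n k j))
    linarith [h k j hj]
  induction k with
  | zero =>
    intro j hj
    have h0 : |b (grid n 0 0)| ≤ |b 0| := by rw [grid_zero]
    obtain rfl | rfl : j = 0 ∨ j = 1 := by
      rw [pow_zero] at hj
      omega
    · simpa using h0.trans (le_add_of_nonneg_right hA)
    · simpa using step 0 0 _ (by simp) h0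
  | succ k ih =>
    intro j hj
    rw [Finset.sum_range_succ, mul_add, ← add_assoc]
    have hpow : 2 ^ (k + 1) = 2 * 2 ^ k := pow_succ' 2 k
    obtain ⟨m, rfl | rfl⟩ := Nat.even_or_odd' j
    · rw [grid_succ_two_mul]
      exact (ih m (by omega)).trans (le_add_of_nonneg_right (by positivity))
    · refine step (k + 1) (2 * m) _ (by omega) ?_
      rw [grid_succ_two_mul]
      exact ih m (by omega)

lemma abs_le_of_le_two_pow {b : ℝ≥0 → ℝ} (hb : Continuous b) {A r : ℝ} {n : ℕ} (hA : 0 ≤ A)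
    (hr : 0 ≤ r) (hr1 : r < 1)
    (h : ∀ k j, j < 2 ^ k → |b (grid n k (j + 1)) - b (grid n k j)| ≤ A * r ^ k)
    {t : ℝ≥0} (ht : (t : ℝ) ≤ 2 ^ n) : |b t| ≤ |b 0| + A * (1 - r)⁻¹ := by
  refine le_of_tendsto ((hb.tendsto t).comp (tendsto_grid n t)).abs (Eventually.of_forall fun k => ?_)
  refine (abs_grid_le hA hr h k _ ?_).trans ?_
  · refine Nat.floor_le_of_le ?_
    push_cast
    exact mul_le_of_le_one_left (by positivity) ((div_le_one (by positivity)).2 ht)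
  · gcongr
    rw [← tsum_geometric_of_lt_one hr hr1]
    exact (summable_geometric_of_lt_one hr hr1).sum_le_tsum _ fun i _ => by positivity

lemma exists_growth_bound {b : ℝ≥0 → ℝ} (hb : Continuous b) {C r γ : ℝ} (hC : 0 ≤ C)
    (hγ : 0 ≤ γ) (hr : 0 ≤ r) (hr1 : r < 1)
    (h : ∀ n k j, j < 2 ^ k →
      |b (grid n k (j + 1)) - b (grid n k j)| ≤ C * (((2 : ℝ) ^ γ) ^ n * r ^ k)) :
    ∃ C', 0 ≤ C' ∧ ∀ t : ℝ≥0, |b t| ≤ C' * (1 + (t : ℝ)) ^ γ := by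
  have hr' : 0 < 1 - r := by linarith
  refine ⟨|b 0| + C * 2 ^ γ * (1 - r)⁻¹, by positivity, fun t => ?_⟩
  have hu : (1 : ℝ) ≤ 1 + t := by linarith [t.coe_nonneg]
  -- With `2 ^ n ≤ 1 + t < 2 ^ (n + 1)`, the grid on `[0, 2 ^ (n + 1)]` covers `t`, at the price of
  -- a factor `2 ^ γ`.
  obtain ⟨n, hn1, hn2⟩ := exists_nat_pow_near hu one_lt_two
  refine (abs_le_of_le_two_pow (n := n + 1) hb (A := C * ((2 : ℝ) ^ γ) ^ (n + 1)) (by positivity)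
    hr hr1 (fun k j hj => ?_) (by linarith)).trans ?_
  · rw [mul_assoc]
    exact h (n + 1) k j hj
  · have h1 : ((2 : ℝ) ^ γ) ^ n ≤ (1 + (t : ℝ)) ^ γ := by
      rw [Real.rpow_pow_comm (by norm_num)]
      exact Real.rpow_le_rpow (by positivity) hn1 hγ
    have h2 : |b 0| ≤ |b 0| * (1 + (t : ℝ)) ^ γ :=
      le_mul_of_one_le_right (abs_nonneg _) (Real.one_le_rpow hu hγ)
    rw [add_mul, pow_succ]
    refine add_le_add h2 ?_
    calc C * (((2 : ℝ) ^ γ) ^ n * 2 ^ γ) * (1 - r)⁻¹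
        ≤ C * ((1 + (t : ℝ)) ^ γ * 2 ^ γ) * (1 - r)⁻¹ := by gcongr
      _ = _ := by ring

end DyadicChaining

/-! ### Almost sure growth of fractional Brownian motion -/

namespace IsFractionalBrownianMotion

open DyadicChaining

variable {Ω : Type*} [MeasurableSpace Ω] {H : ℝ} {B : ℝ≥0 → Ω → ℝ} {P : Measure Ω}

lemma integral_sub (hB : IsFractionalBrownianMotion H B P) (s t : ℝ≥0) :
    ∫ ω, (B t ω - B s ω) ∂P = 0 := by
  rw [MeasureTheory.integral_sub (hB.gaussian.hasGaussianLaw_eval t).integrable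
    (hB.gaussian.hasGaussianLaw_eval s).integrable, hB.mean_zero, hB.mean_zero, sub_zero]

lemma integral_sub_sq (hH : 0 < H) (hB : IsFractionalBrownianMotion H B P) (s t : ℝ≥0) :
    ∫ ω, (B t ω - B s ω) ^ 2 ∂P = |(t : ℝ) - s| ^ (2 * H) := by
  have hs := (hB.gaussian.hasGaussianLaw_eval s).memLp_two
  have ht := (hB.gaussian.hasGaussianLaw_eval t).memLp_two
  have h1 : ∀ ω, (B t ω - B s ω) ^ 2 = B t ω * B t ω - 2 * (B s ω * B t ω) + B s ω * B s ω :=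
    fun ω => by ring
  have htt : Integrable (fun ω => B t ω * B t ω) P := ht.integrable_mul ht
  have hst : Integrable (fun ω => B s ω * B t ω) P := hs.integrable_mul ht
  have hss : Integrable (fun ω => B s ω * B s ω) P := hs.integrable_mul hs
  have hd : Integrable (fun ω => B t ω * B t ω - 2 * (B s ω * B t ω)) P :=
    htt.sub (hst.const_mul 2)
  simp_rw [h1]
  rw [integral_add hd hss, MeasureTheory.integral_sub htt (hst.const_mul 2),
    integral_const_mul, hB.covariance, hB.covariance, hB.covariance]
  simp only [sub_self, abs_zero, Real.zero_rpow (mul_pos two_pos hH).ne', abs_sub_comm (s : ℝ) t]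
  ring

/-- Writing the increment as a scaled standard Gaussian reduces all its absolute moments to
constants depending only on `p`. -/
lemma map_sub (hH : 0 < H) (hB : IsFractionalBrownianMotion H B P) (s t : ℝ≥0) :
    P.map (fun ω => B t ω - B s ω)
      = (gaussianReal 0 1).map ((|(t : ℝ) - s| ^ H) * ·) := by
  have hg := hB.gaussian.hasGaussianLaw_fun_sub (s := t) (t := s)
  rw [hg.map_eq_gaussianReal, variance_of_integral_eq_zero hg.aemeasurable (hB.integral_sub s t),
    hB.integral_sub, hB.integral_sub_sq hH, gaussianReal_map_const_mul]
  congr 1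
  · simp
  · ext
    rw [Real.coe_toNNReal _ (by positivity), mul_one, NNReal.coe_mk, mul_comm, Real.rpow_mul
      (abs_nonneg _), Real.rpow_two]

lemma integrable_abs_sub_pow (hB : IsFractionalBrownianMotion H B P) (s t : ℝ≥0) {p : ℕ}
    (hp : p ≠ 0) : Integrable (fun ω => |B t ω - B s ω| ^ p) P :=
  ((hB.gaussian.hasGaussianLaw_fun_sub (s := t) (t := s)).memLp
    (p := p) (by simp)).integrable_norm_pow hp

lemma integral_abs_sub_pow (hH : 0 < H) (hB : IsFractionalBrownianMotion H B P) (s t : ℝ≥0)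
    (p : ℕ) : ∫ ω, |B t ω - B s ω| ^ p ∂P
      = (|(t : ℝ) - s| ^ H) ^ p * ∫ x, |x| ^ p ∂(gaussianReal 0 1) := by
  have hg := hB.gaussian.hasGaussianLaw_fun_sub (s := t) (t := s)
  rw [← integral_map (f := fun x : ℝ => |x| ^ p) hg.aemeasurable (by fun_prop), hB.map_sub hH,
    integral_map (by fun_prop) (by fun_prop), ← integral_const_mul]
  congr with x
  rw [abs_mul, mul_pow, abs_of_nonneg (a := |(t : ℝ) - s| ^ H) (by positivity)]

/-- Expected total of the normalised `p`-th powers of the increments of level `(n, k)`. -/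
lemma sum_lintegral_grid (hH : 0 < H) (hB : IsFractionalBrownianMotion H B P) {R r : ℝ}
    (hR : 0 < R) (hr : 0 < r) {p : ℕ} (hp : p ≠ 0) (n k : ℕ) :
    ∑ j ∈ Finset.range (2 ^ k), ∫⁻ ω, ENNReal.ofReal
        ((|B (grid n k (j + 1)) ω - B (grid n k j) ω| / (R ^ n * r ^ k)) ^ p) ∂P
      = ENNReal.ofReal (∫ x, |x| ^ p ∂(gaussianReal 0 1)) *
        (ENNReal.ofReal ((2 ^ H / R) ^ p) ^ n * ENNReal.ofReal (2 / (2 ^ H * r) ^ p) ^ k) := by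
  have h1 : ∀ j, ∫⁻ ω, ENNReal.ofReal
      ((|B (grid n k (j + 1)) ω - B (grid n k j) ω| / (R ^ n * r ^ k)) ^ p) ∂P
      = ENNReal.ofReal (((2 ^ H) ^ n / (2 ^ H) ^ k / (R ^ n * r ^ k)) ^ p *
        ∫ x, |x| ^ p ∂(gaussianReal 0 1)) := by
    intro j
    simp_rw [div_pow _ (R ^ n * r ^ k) p]
    rw [← ofReal_integral_eq_lintegral_ofReal ((hB.integrable_abs_sub_pow _ _ hp).div_const _)
      (Eventually.of_forall fun ω => by positivity), integral_div, hB.integral_abs_sub_pow hH,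
      coe_grid_succ_sub, abs_of_pos (by positivity), Real.div_rpow (by positivity) (by positivity),
      Real.rpow_pow_comm two_pos.le, Real.rpow_pow_comm two_pos.le]
    congr 1
    ring
  have hc : 0 ≤ ∫ x, |x| ^ p ∂(gaussianReal 0 1) := integral_nonneg fun x => by positivity
  simp_rw [h1]
  rw [Finset.sum_const, Finset.card_range, nsmul_eq_mul, ← ENNReal.ofReal_natCast,
    ← ENNReal.ofReal_mul (by positivity), ← ENNReal.ofReal_pow (by positivity),
    ← ENNReal.ofReal_pow (by positivity), ← ENNReal.ofReal_mul (by positivity),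
    ← ENNReal.ofReal_mul hc]
  congr 1
  push_cast
  simp only [div_pow, mul_pow, ← pow_mul, mul_comm p]
  field_simp

/-- The normalised `p`-th powers have finite expected sum over all scales, levels and positions, so
their sum is almost surely finite and dominates each single term. -/
theorem ae_exists_increment_bound (hH : 0 < H) (hB : IsFractionalBrownianMotion H B P) {R r : ℝ}
    (hR : 2 ^ H < R) (hr : 0 < r) (hr1 : 1 < 2 ^ H * r) :
    ∀ᵐ ω ∂P, ∃ C, 0 ≤ C ∧ ∀ n k j, j < 2 ^ k →
      |B (grid n k (j + 1)) ω - B (grid n k j) ω| ≤ C * (R ^ n * r ^ k) := by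
  have h2H : (0 : ℝ) < 2 ^ H := by positivity
  have hR0 : 0 < R := h2H.trans hR
  -- The moment `p` must be large enough for `(2 ^ H * r) ^ p` to beat the `2 ^ k` increments of
  -- level `k`; convergence in `n` only needs `2 ^ H < R`.
  obtain ⟨p, hp2⟩ := pow_unbounded_of_one_lt 2 hr1
  have hp : p ≠ 0 := by
    rintro rfl
    norm_num at hp2
  set X : ℕ → ℕ → ℕ → Ω → ENNReal := fun n k j ω => ENNReal.ofReal
    ((|B (grid n k (j + 1)) ω - B (grid n k j) ω| / (R ^ n * r ^ k)) ^ p) with hX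
  have hXm : ∀ n k j, AEMeasurable (X n k j) P := fun n k j =>
    ((((hB.gaussian.hasGaussianLaw_fun_sub (s := grid n k (j + 1))
      (t := grid n k j)).aemeasurable.abs).div_const _).pow_const p).ennreal_ofReal
  have hXs : ∀ n k, AEMeasurable (fun ω => ∑ j ∈ Finset.range (2 ^ k), X n k j ω) P :=
    fun n k => Finset.aemeasurable_fun_sum _ fun j _ => hXm n k j
  have hfin : ∫⁻ ω, ∑' n, ∑' k, ∑ j ∈ Finset.range (2 ^ k), X n k j ω ∂P ≠ ⊤ := by
    rw [lintegral_tsum fun n => AEMeasurable.tsum (hXs n)]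
    simp_rw [lintegral_tsum (hXs _), lintegral_finsetSum' _ fun j _ => hXm _ _ j, hX,
      hB.sum_lintegral_grid hH hR0 hr hp, ENNReal.tsum_mul_left, ENNReal.tsum_geometric]
    rw [ENNReal.tsum_mul_right, ENNReal.tsum_geometric]
    refine ENNReal.mul_ne_top ENNReal.ofReal_ne_top (ENNReal.mul_ne_top ?_ ?_)
    · refine ENNReal.inv_ne_top.2 (tsub_pos_of_lt (ENNReal.ofReal_lt_one.2 ?_)).ne'
      exact pow_lt_one₀ (by positivity) ((div_lt_one hR0).2 hR) hp
    · refine ENNReal.inv_ne_top.2 (tsub_pos_of_lt (ENNReal.ofReal_lt_one.2 ?_)).ne'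
      exact (div_lt_one (by positivity)).2 hp2
  filter_upwards [ae_lt_top' (AEMeasurable.tsum fun n => AEMeasurable.tsum (hXs n))
    hfin] with ω hω
  -- The extra `1` covers ratios `x ≤ 1`, for which `x ≤ x ^ p` may fail.
  refine ⟨1 + (∑' n, ∑' k, ∑ j ∈ Finset.range (2 ^ k), X n k j ω).toReal, by positivity,
    fun n k j hj => ?_⟩
  rw [← div_le_iff₀ (by positivity)]
  have h1 : X n k j ω ≤ ∑' n, ∑' k, ∑ j ∈ Finset.range (2 ^ k), X n k j ω :=
    (Finset.single_le_sum_of_canonicallyOrdered (f := fun j => X n k j ω)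
      (Finset.mem_range.2 hj)).trans
    ((ENNReal.le_tsum (f := fun k => ∑ j ∈ Finset.range (2 ^ k), X n k j ω) k).trans
      (ENNReal.le_tsum (f := fun n => ∑' k, ∑ j ∈ Finset.range (2 ^ k), X n k j ω) n))
  have h2 := (ENNReal.ofReal_le_iff_le_toReal hω.ne).1 h1
  set x := |B (grid n k (j + 1)) ω - B (grid n k j) ω| / (R ^ n * r ^ k)
  rcases le_total x 1 with hx | hx
  · exact hx.trans (le_add_of_nonneg_right ENNReal.toReal_nonneg)
  · linarith [le_self_pow₀ hx hp]

/-- Fractional Brownian motion grows at most like `t ^ γ` for every `γ > H`. -/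
theorem ae_exists_growth_bound (hH : 0 < H) (hB : IsFractionalBrownianMotion H B P) {γ : ℝ}
    (hγ : H < γ) :
    ∀ᵐ ω ∂P, ∃ C, 0 ≤ C ∧ ∀ t : ℝ≥0, |B t ω| ≤ C * (1 + (t : ℝ)) ^ γ := by
  have hr1 : (2 : ℝ) ^ (-(H / 2)) < 1 :=
    Real.rpow_lt_one_of_one_lt_of_neg one_lt_two (by linarith)
  -- The ratio `r = 2 ^ (-(H / 2))` is below `1`, as chaining requires, while `2 ^ H * r = 2 ^ (H /
  -- 2)` exceeds `1`, as the moment bound requires.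
  filter_upwards [hB.continuous_paths, hB.ae_exists_increment_bound hH (R := 2 ^ γ)
    (r := 2 ^ (-(H / 2))) (Real.rpow_lt_rpow_of_exponent_lt one_lt_two hγ) (by positivity)
    (by
      rw [← Real.rpow_add two_pos]
      exact Real.one_lt_rpow one_lt_two (by linarith))] with ω hc ⟨C, hC, h⟩
  exact exists_growth_bound hc hC (hH.trans hγ).le (by positivity) hr1 h

end IsFractionalBrownianMotion

theorem mainTheorem3 {Ω : Type*} [MeasurableSpace Ω] (P : Measure Ω) [IsProbabilityMeasure P]
    (H : ℝ) (hH : H ∈ Ioo (0 : ℝ) (1 / 2)) (B : ℝ≥0 → Ω → ℝ)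
    (hB : IsFractionalBrownianMotion H B P)
    (a σ x₀ : ℝ) (ha : 0 < a) (hσ : 0 < σ) (hx₀ : 0 < x₀) :
    -- the defining limit of the process exists
    (∀ᵐ ω ∂P, ∀ t : ℝ≥0,
      Tendsto (fun ε => FracBessel.approx a σ x₀ ε (fun s => B s ω) t) (𝓝[>] (0 : ℝ))
        (𝓝 (fracBessel a σ x₀ B t ω))) ∧
    (∀ᵐ ω ∂P,
      (0 : EReal) < liminf (fun t : ℝ≥0 => (fracBessel a σ x₀ B t ω : EReal)) atTop ∧
      ∃ T : ℝ≥0, ∀ t : ℝ≥0, T ≤ t → 0 < fracBessel a σ x₀ B t ω) ∧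
    (∀ᵐ ω ∂P, ∀ α : ℝ, 1 / 2 < α →
      limsup (fun t : ℝ≥0 => ((fracBessel a σ x₀ B t ω / (t : ℝ) ^ α : ℝ) : EReal)) atTop
        = 0) := by
  -- The condition `H < 1/2` enters here, leaving room for a growth exponent strictly between `H`
  -- and `1/2`.
  obtain ⟨γ, hHγ, hγ⟩ := exists_between hH.2
  have hγ0 : 0 ≤ γ := (hH.1.trans hHγ).le
  have hgrowth := hB.ae_exists_growth_bound hH.1 hHγ
  refine ⟨?_, ?_, ?_⟩
  · filter_upwards [hB.continuous_paths] with ω hc t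
    exact FracBessel.tendsto_approx_path ha hσ hc t
  · filter_upwards [hB.continuous_paths, hgrowth] with ω hc ⟨C, hC, hb⟩
    have h := FracBessel.eventually_one_le_path ha hσ hx₀ hc hC hγ0 hγ hb
    constructor
    · refine zero_lt_one.trans_le (le_liminf_of_le (by isBoundedDefault) ?_)
      filter_upwards [h] with t ht
      exact_mod_cast ht
    · obtain ⟨T, hT⟩ := eventually_atTop.1 h
      exact ⟨T, fun t ht => zero_lt_one.trans_le (hT t ht)⟩
  · filter_upwards [hB.continuous_paths, hgrowth] with ω hc ⟨C, hC, hb⟩ α hα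
    have h := FracBessel.tendsto_path_div_rpow ha hσ hx₀ hc hC hγ0 hγ hb hα
    exact ((continuous_coe_real_ereal.tendsto 0).comp h).limsup_eq
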